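/- Let $d\ge 0$ and let $\gamma,\nu$ be $\sigma$-finite (more generally, s-finite) measures on $\mathbb{R}^d$; no other assumption is made on them. Consider the branching process in which every individual located at $y$ independently produces children at the points $y+x$, $x\in\xi_\gamma$, where $\xi_\gamma$ is a Poisson sample (Poisson point process) with intensity $\gamma$. Let $\xi$ be the random configuration (points counted with multiplicity) of all descendants, the ancestor excluded, of an ancestor located at $0$; the cluster started at $z$ then consists of $z$ and the points $z+x$, $x\in\xi$. The Hawkes process with immigrant intensity $\nu$ is the superposition of independent clusters started at the points of a Poisson sample of intensity $\nu$. Define the probability generating functional of the cluster started at $z$ and the moment generating functional by $$G_z(h)=h(z)\,\mathbb{E}\Big[\prod_{x\in\xi}h(z+x)\Big],\qquad M_z(f)=G_z(e^f),$$ and let $M_\nu(f)=G_\nu(e^f)$, where $G_\nu(h)=\mathbb{E}\big[\prod_{x}h(x)\big]$, the product being over the points of the Hawkes process. Let $f:\mathbb{R}^d\to\mathbb{R}$ be Borel measurable. Call $f$ *integrable for the cluster at $z$* if $\sum_{x\in\xi}|f(z+x)|<\infty$ almost surely and $\mathbb{E}\big[\exp\big(f(z)+\sum_{x\in\xi}f(z+x)\big)\big]<\infty$,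 and *integrable for the Hawkes process* if the sum of $|f|$ over the points of the Hawkes process is almost surely finite and the exponential of the sum of $f$ over these points has finite expectation. (1) For every $z\in\mathbb{R}^d$ such that $f$ is integrable for the cluster at $z$: $M_z(f)=\mathbb{E}\big[\exp\big(f(z)+\sum_{x\in\xi}f(z+x)\big)\big]$; $f$ is integrable for the cluster at $z+x$ for $\gamma$-almost every $x$; the function $x\mapsto M_{z+x}(f)-1$ is $\gamma$-integrable; and $$M_z(f)=\exp\Big(f(z)+\int_{\mathbb{R}^d}\big(M_{z+x}(f)-1\big)\,\gamma(dx)\Big).$$ (2) If $f$ is integrable for the Hawkes process, then $M_\nu(f)$ is the expectation of the exponential of the sum of $f$ over the points of the Hawkes process; $f$ is integrable for the cluster at $z$ for $\nu$-almost every $z$; the function $z\mapsto M_z(f)-1$ is $\nu$-integrable; and $$M_\nu(f)=\exp\Big(\int_{\mathbb{R}^d}\big(M_z(f)-1\big)\,\nu(dz)\Big).$$ -/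

import Mathlib

open MeasureTheory ProbabilityTheory

namespace Hawkes

noncomputable section

/-! ### Poisson samples -/

/-- The normalization `μ / μ(E)` of a finite measure (a point mass at `0` if `μ = 0`). -/
def normalized {E : Type*} [MeasurableSpace E] [Zero E] (μ : Measure E) : Measure E :=
  open Classical in if μ = 0 then Measure.dirac 0 else (μ Set.univ)⁻¹ • μ

instance {E : Type*} [MeasurableSpace E] [Zero E] (μ : Measure E) [IsFiniteMeasure μ] :
    IsProbabilityMeasure (normalized μ) := by
  unfold normalized
  split_ifs with h
  · infer_instance
  · refine ⟨?_⟩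
    rw [Measure.smul_apply, smul_eq_mul]
    exact ENNReal.inv_mul_cancel (by simpa using h) (measure_ne_top μ _)

/-- A sample, organized in countably many layers: layer `j` consists of a number `(s j).1` of points
and of a sequence `(s j).2` of locations, whose first `(s j).1` terms are the points of the layer. -/
abbrev Sample (E : Type*) : Type _ := ℕ → ℕ × (ℕ → E)

/-- The labels `i = (j, k)` that carry a point of the sample (the `k`-th point of layer `j`). -/
def Sample.Occurs {E : Type*} (s : Sample E) (i : ℕ × ℕ) : Prop := i.2 < (s i.1).1

/-- The location of the point with label `i = (j, k)`. -/
def Sample.point {E : Type*} (s : Sample E) (i : ℕ × ℕ) : E := (s i.1).2 i.2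

/-- The law of a Poisson sample with intensity `μ`. The intensity is written as a sum `∑ j, μ j` of
finite measures, and the sample is the superposition of independent layers: layer `j` has a Poisson
number of points, with mean `μ j (E)`, located at independent points of law `μ j / μ j (E)`. -/
def sampleLaw {E : Type*} [MeasurableSpace E] [Zero E] (μ : Measure E) [SFinite μ] :
    Measure (Sample E) :=
  Measure.infinitePi fun j : ℕ =>
    (poissonMeasure (sfiniteSeq μ j Set.univ).toNNReal).prod
      (Measure.infinitePi fun _ : ℕ => normalized (sfiniteSeq μ j))

instance {E : Type*} [MeasurableSpace E] [Zero E] (μ : Measure E) [SFinite μ] :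
    IsProbabilityMeasure (sampleLaw μ) := by
  unfold sampleLaw
  infer_instance

/-! ### The branching process started from one point -/

/-- Labels of individuals: `[]` is the ancestor, and `c :: u` is the child of `u` with label `c`. -/
abbrev Node : Type := List (ℕ × ℕ)

/-- Every (potential) individual has a sample of offspring, centered at `0`. -/
abbrev Tree (E : Type*) : Type _ := Node → Sample E

/-- The individuals that are actually born. -/
def Tree.Born {E : Type*} (T : Tree E) : Node → Prop
  | [] => True
  | c :: u => Tree.Born T u ∧ (T u).Occurs c

/-- The position of an individual relative to the ancestor: the offspring of an individual at `x`
is its sample shifted by `x`. -/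
def Tree.pos {E : Type*} [AddZeroClass E] (T : Tree E) : Node → E
  | [] => 0
  | c :: u => Tree.pos T u + (T u).point c

/-- The point measure of all descendants (the ancestor excluded) of an ancestor at `0`. -/
def progeny {E : Type*} [MeasurableSpace E] [AddZeroClass E] (T : Tree E) : Measure E :=
  open Classical in
  Measure.sum fun u : Node => if u ≠ [] ∧ T.Born u then Measure.dirac (T.pos u) else 0

/-- The samples of all individuals are independent Poisson samples with intensity `γ`. -/
def treeLaw {E : Type*} [MeasurableSpace E] [Zero E] (γ : Measure E) [SFinite γ] :
    Measure (Tree E) :=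
  Measure.infinitePi fun _ : Node => sampleLaw γ

instance {E : Type*} [MeasurableSpace E] [Zero E] (γ : Measure E) [SFinite γ] :
    IsProbabilityMeasure (treeLaw γ) := by
  unfold treeLaw
  infer_instance

/-- The law, on the space of measures on `E`, of the progeny `ξ` of an ancestor at `0`, for the
branching process with Poisson offspring intensity `γ`. -/
def progenyLaw {E : Type*} [MeasurableSpace E] [AddZeroClass E] (γ : Measure E) [SFinite γ] :
    Measure (Measure E) :=
  (treeLaw γ).map progeny

/-! ### The Hawkes process -/

/-- The point measure of the Hawkes process: every immigrant `z` of the sample `ω.1` contributes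
itself and the progeny of its own tree, shifted by `z`. -/
def cascade {E : Type*} [MeasurableSpace E] [AddZeroClass E]
    (ω : Sample E × (ℕ × ℕ → Tree E)) : Measure E :=
  open Classical in
  Measure.sum fun i : ℕ × ℕ =>
    if ω.1.Occurs i then
      Measure.dirac (ω.1.point i) + (progeny (ω.2 i)).map (fun x => ω.1.point i + x)
    else 0

/-- The law of the Hawkes process with Poisson offspring intensity `γ` and Poisson immigrant
intensity `ν`: the trees of the immigrants are independent, and independent of the immigrants. -/
def hawkesLaw {E : Type*} [MeasurableSpace E] [AddZeroClass E] (γ ν : Measure E)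
    [SFinite γ] [SFinite ν] : Measure (Measure E) :=
  ((sampleLaw ν).prod (Measure.infinitePi fun _ : ℕ × ℕ => treeLaw γ)).map cascade

/-! ### Measurability: the laws above are probability laws -/

theorem measurableSet_occurs {E : Type*} [MeasurableSpace E] (i : ℕ × ℕ) :
    MeasurableSet {s : Sample E | s.Occurs i} := by
  have h : Measurable fun s : Sample E => (s i.1).1 := by fun_prop
  exact h (t := {n | i.2 < n}) (MeasurableSet.of_discrete)

theorem measurable_point {E : Type*} [MeasurableSpace E] (i : ℕ × ℕ) :
    Measurable fun s : Sample E => s.point i := by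
  unfold Sample.point
  fun_prop

theorem measurableSet_born {E : Type*} [MeasurableSpace E] (u : Node) :
    MeasurableSet {T : Tree E | T.Born u} := by
  induction u with
  | nil => simp [Tree.Born]
  | cons c u ih =>
    have hu : Measurable fun T : Tree E => T u := measurable_pi_apply u
    have h : MeasurableSet {T : Tree E | (T u).Occurs c} := hu (measurableSet_occurs c)
    exact ih.inter h

theorem measurable_pos {E : Type*} [MeasurableSpace E] [AddZeroClass E] [MeasurableAdd₂ E]
    (u : Node) : Measurable fun T : Tree E => T.pos u := by
  induction u with
  | nil => exact measurable_const
  | cons c u ih => exact ih.add ((measurable_point c).comp (measurable_pi_apply u))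

theorem measurable_progeny {E : Type*} [MeasurableSpace E] [AddZeroClass E] [MeasurableAdd₂ E] :
    Measurable (progeny : Tree E → Measure E) := by
  classical
  refine Measure.measurable_of_measurable_coe _ fun A hA => ?_
  simp only [progeny, Measure.sum_apply _ hA]
  refine Measurable.tsum fun u => ?_
  refine (Measure.measurable_coe hA).comp (Measurable.ite ?_ ?_ measurable_const)
  · exact (MeasurableSet.const (u ≠ [])).inter (measurableSet_born u)
  · exact Measure.measurable_dirac.comp (measurable_pos u)

theorem measurable_cascade {E : Type*} [MeasurableSpace E] [AddZeroClass E] [MeasurableAdd₂ E] :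
    Measurable (cascade : Sample E × (ℕ × ℕ → Tree E) → Measure E) := by
  classical
  refine Measure.measurable_of_measurable_coe _ fun A hA => ?_
  simp only [cascade, Measure.sum_apply _ hA]
  refine Measurable.tsum fun i => ?_
  have hp : Measurable fun ω : Sample E × (ℕ × ℕ → Tree E) => ω.1.point i :=
    (measurable_point i).comp measurable_fst
  have h0 : MeasurableSet {ω : Sample E × (ℕ × ℕ → Tree E) | ω.1.Occurs i} :=
    measurable_fst (measurableSet_occurs i)
  have h1 : Measurable fun ω : Sample E × (ℕ × ℕ → Tree E) =>
      (Measure.dirac (ω.1.point i)) A :=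
    (Measure.measurable_coe hA).comp (Measure.measurable_dirac.comp hp)
  have h2 : Measurable fun ω : Sample E × (ℕ × ℕ → Tree E) =>
      ((progeny (ω.2 i)).map (fun x => ω.1.point i + x)) A := by
    have key : ∀ ω : Sample E × (ℕ × ℕ → Tree E),
        ((progeny (ω.2 i)).map (fun x => ω.1.point i + x)) A =
          ∑' u : Node, (if u ≠ [] ∧ (ω.2 i).Born u then
            Measure.dirac (ω.1.point i + (ω.2 i).pos u) else 0) A := by
      intro ω
      have hm : Measurable fun x : E => ω.1.point i + x := measurable_const.add measurable_id
      rw [Measure.map_apply hm hA, progeny, Measure.sum_apply _ (hm hA)]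
      refine tsum_congr fun u => ?_
      split_ifs
      · rw [Measure.dirac_apply' _ (hm hA), Measure.dirac_apply' _ hA]
        rfl
      · simp
    simp only [key]
    refine Measurable.tsum fun u => ?_
    have ht : Measurable fun ω : Sample E × (ℕ × ℕ → Tree E) => ω.2 i :=
      (measurable_pi_apply i).comp measurable_snd
    refine (Measure.measurable_coe hA).comp (Measurable.ite ?_ ?_ measurable_const)
    · exact (MeasurableSet.const (u ≠ [])).inter (ht (measurableSet_born u))
    · exact Measure.measurable_dirac.comp (hp.add ((measurable_pos u).comp ht))
  have h3 : ∀ ω : Sample E × (ℕ × ℕ → Tree E),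
      (if ω.1.Occurs i then
        Measure.dirac (ω.1.point i) + (progeny (ω.2 i)).map (fun x => ω.1.point i + x)
      else 0) A =
      if ω.1.Occurs i then
        (Measure.dirac (ω.1.point i)) A + ((progeny (ω.2 i)).map (fun x => ω.1.point i + x)) A
      else 0 := by
    intro ω
    split_ifs <;> simp
  simp only [h3]
  exact Measurable.ite h0 (h1.add h2) measurable_const

instance {E : Type*} [MeasurableSpace E] [AddZeroClass E] [MeasurableAdd₂ E] (γ : Measure E)
    [SFinite γ] : IsProbabilityMeasure (progenyLaw γ) :=
  Measure.isProbabilityMeasure_map measurable_progeny.aemeasurable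

instance {E : Type*} [MeasurableSpace E] [AddZeroClass E] [MeasurableAdd₂ E] (γ ν : Measure E)
    [SFinite γ] [SFinite ν] : IsProbabilityMeasure (hawkesLaw γ ν) :=
  Measure.isProbabilityMeasure_map measurable_cascade.aemeasurable

/-! ### Generating functionals

A configuration `ξ` is identified with the point measure `η` that gives every point its
multiplicity, so that `∑_{x ∈ ξ} f x = ∫ f dη` and `∏_{x ∈ ξ} h x = ∏_x h x ^ η {x}`. -/

/-- The product `∏_{x ∈ ξ} h x` over the points of a configuration, with multiplicities. -/
def pointProd {E : Type*} [MeasurableSpace E] (h : E → ℝ) (η : Measure E) : ℝ :=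
  ∏' x : E, h x ^ η.real {x}

/-- The probability generating functional `G_z(h) = h(z) E[∏_{x ∈ ξ} h(z + x)]` of the branching
process started from a single point at `z`. -/
def clusterPGFl {E : Type*} [MeasurableSpace E] [AddZeroClass E] (γ : Measure E) [SFinite γ]
    (z : E) (h : E → ℝ) : ℝ :=
  h z * ∫ η, pointProd (fun x => h (z + x)) η ∂(progenyLaw γ)

/-- The moment generating functional `M_z(f) = G_z(e^f)`. -/
def clusterMGFl {E : Type*} [MeasurableSpace E] [AddZeroClass E] (γ : Measure E) [SFinite γ]
    (z : E) (f : E → ℝ) : ℝ :=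
  clusterPGFl γ z fun x => Real.exp (f x)

/-- The probability generating functional `G_ν(h) = E[∏_{x ∈ ξ} h(x)]` of the Hawkes process. -/
def hawkesPGFl {E : Type*} [MeasurableSpace E] [AddZeroClass E] (γ ν : Measure E)
    [SFinite γ] [SFinite ν] (h : E → ℝ) : ℝ :=
  ∫ η, pointProd h η ∂(hawkesLaw γ ν)

/-- The moment generating functional `M_ν(f) = G_ν(e^f)` of the Hawkes process. -/
def hawkesMGFl {E : Type*} [MeasurableSpace E] [AddZeroClass E] (γ ν : Measure E)
    [SFinite γ] [SFinite ν] (f : E → ℝ) : ℝ :=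
  hawkesPGFl γ ν fun x => Real.exp (f x)

/-- `f` is sufficiently integrable for the cluster started at `z`: its sum over the cluster
converges absolutely almost surely, and has a finite exponential moment. -/
def ClusterIntegrable {E : Type*} [MeasurableSpace E] [AddZeroClass E] (γ : Measure E) [SFinite γ]
    (z : E) (f : E → ℝ) : Prop :=
  (∀ᵐ η ∂(progenyLaw γ), Integrable (fun x => f (z + x)) η) ∧
    Integrable (fun η => Real.exp (f z + ∫ x, f (z + x) ∂η)) (progenyLaw γ)

/-- `f` is sufficiently integrable for the Hawkes process: its sum over the process converges
absolutely almost surely, and has a finite exponential moment. -/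
def HawkesIntegrable {E : Type*} [MeasurableSpace E] [AddZeroClass E] (γ ν : Measure E)
    [SFinite γ] [SFinite ν] (f : E → ℝ) : Prop :=
  (∀ᵐ η ∂(hawkesLaw γ ν), Integrable f η) ∧
    Integrable (fun η => Real.exp (∫ x, f x ∂η)) (hawkesLaw γ ν)

end

end Hawkes

open scoped ENNReal NNReal Topology
open Filter

namespace Hawkes

/-! Mark each immigrant with its family tree. The marked immigrants form a Poisson sample of pairs
(z, T) with intensity ν ⊗ `treeLaw γ` (`sampleLaw_prod_eq`), and the sum of f over the Hawkes
process is the sum over this sample of F(z, T), the sum of f over the cluster of z. The exponential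
formula E exp(∑ F) = exp ∫ (e^F - 1) (`layeredLaw_exp`), followed by Fubini, gives (2), because the
inner integral over T is M_z(f) - 1. For (1), the children of the ancestor are a Poisson sample of
intensity γ whose subtrees are independent copies of the whole tree. Hence the progeny is itself a
Hawkes process with immigrant intensity γ (`progenyLaw_eq_hawkesLaw`): apply (2) to the translate of
f and multiply by e^{f(z)}.

In the exponential formula F has no sign and only E exp(∑ F) < ∞ is assumed, so neither monotone nor
dominated convergence leads from finitely many layers to all of them. Fatou's lemma, applied both to
partial sums and to remainders, does (`tendsto_prod_lintegral_exp`). This gives only a limit of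
partial sums of ∫ (e^F - 1); the same limit for -|F|, whose exponential is bounded, upgrades it to
integrability.

The generating functionals are products over atoms. They become exp ∫ f dη because almost every η is
purely atomic where f ≠ 0 (`pointProd_exp`). -/

theorem infinitePi_map_unzip {ι : Type*} {X Y : ι → Type*} [∀ i, MeasurableSpace (X i)]
    [∀ i, MeasurableSpace (Y i)] (μ : ∀ i, Measure (X i)) (ν : ∀ i, Measure (Y i))
    [∀ i, IsProbabilityMeasure (μ i)] [∀ i, IsProbabilityMeasure (ν i)] :
    (Measure.infinitePi fun i => (μ i).prod (ν i)).map
        (fun p => ((fun i => (p i).1, fun i => (p i).2) : (∀ i, X i) × (∀ i, Y i))) =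
      (Measure.infinitePi μ).prod (Measure.infinitePi ν) := by
  classical
  have hm : Measurable fun p : ∀ i, X i × Y i =>
      ((fun i => (p i).1, fun i => (p i).2) : (∀ i, X i) × (∀ i, Y i)) := by fun_prop
  refine (Measure.prod_eq_generateFrom generateFrom_squareCylinders generateFrom_squareCylinders
    (isPiSystem_squareCylinders (fun _ => MeasurableSpace.isPiSystem_measurableSet) (by simp))
    (isPiSystem_squareCylinders (fun _ => MeasurableSpace.isPiSystem_measurableSet) (by simp))
    ⟨fun _ => Set.univ, fun _ => ⟨∅, fun _ => Set.univ, by simp, by simp⟩,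
      fun _ => measure_lt_top _ _, Set.iUnion_const _⟩
    ⟨fun _ => Set.univ, fun _ => ⟨∅, fun _ => Set.univ, by simp, by simp⟩,
      fun _ => measure_lt_top _ _, Set.iUnion_const _⟩ ?_).symm
  rintro _ ⟨I, s, hs, rfl⟩ _ ⟨J, t, ht, rfl⟩
  simp only [Set.mem_pi, Set.mem_univ, forall_const, Set.mem_ofPred_eq] at hs ht
  have hsI : MeasurableSet ((I : Set ι).pi s) := .pi I.countable_toSet fun _ _ => hs _
  have htJ : MeasurableSet ((J : Set ι).pi t) := .pi J.countable_toSet fun _ _ => ht _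
  rw [Measure.map_apply hm (hsI.prod htJ)]
  -- Both cylinders are read over the common index set `I ∪ J`, padded with `univ`.
  have e : (fun p : ∀ i, X i × Y i =>
      ((fun i => (p i).1, fun i => (p i).2) : (∀ i, X i) × (∀ i, Y i))) ⁻¹'
        ((I : Set ι).pi s ×ˢ (J : Set ι).pi t) =
      ((I ∪ J : Finset ι) : Set ι).pi fun i =>
        (if i ∈ I then s i else Set.univ) ×ˢ (if i ∈ J then t i else Set.univ) := by
    ext p
    simp only [Set.mem_preimage, Set.mem_prod, Set.mem_pi, Finset.mem_coe, Finset.mem_union]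
    constructor
    · rintro ⟨h1, h2⟩ i -
      constructor
      · split_ifs with h <;> simp_all
      · split_ifs with h <;> simp_all
    · intro h
      exact ⟨fun i hi => by simpa [hi] using (h i (Or.inl hi)).1,
        fun i hi => by simpa [hi] using (h i (Or.inr hi)).2⟩
  rw [e, Measure.infinitePi_pi, Measure.infinitePi_pi _ fun i _ => hs i,
    Measure.infinitePi_pi _ fun i _ => ht i]
  · simp only [Measure.prod_prod, Finset.prod_mul_distrib]
    congr 1
    · rw [← Finset.prod_subset Finset.subset_union_left]
      · exact Finset.prod_congr rfl fun i hi => by simp [hi]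
      · intro i _ hi; simp [hi]
    · rw [← Finset.prod_subset Finset.subset_union_right]
      · exact Finset.prod_congr rfl fun i hi => by simp [hi]
      · intro i _ hi; simp [hi]
  · intro i _
    refine MeasurableSet.prod ?_ ?_ <;> split_ifs <;> simp [hs, ht]

/-! ### Poisson layers and the exponential formula -/

/-- The law of a Poisson number of independent points. -/
noncomputable def layerLaw {Y : Type*} [MeasurableSpace Y] (m : ℝ≥0) (ρ : Measure Y) :
    Measure (ℕ × (ℕ → Y)) :=
  (poissonMeasure m).prod (Measure.infinitePi fun _ : ℕ => ρ)

instance {Y : Type*} [MeasurableSpace Y] (m : ℝ≥0) (ρ : Measure Y) [IsProbabilityMeasure ρ] :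
    IsProbabilityMeasure (layerLaw m ρ) := by
  unfold layerLaw
  infer_instance

theorem lintegral_layerLaw_prod {Y : Type*} [MeasurableSpace Y] (m : ℝ≥0) (ρ : Measure Y)
    [IsProbabilityMeasure ρ] {g : Y → ℝ≥0∞} (hg : Measurable g) :
    ∫⁻ p, ∏ k ∈ Finset.range p.1, g (p.2 k) ∂(layerLaw m ρ) =
      ∑' n : ℕ, ENNReal.ofReal (Real.exp (-m) * m ^ n / n.factorial) * (∫⁻ y, g y ∂ρ) ^ n := by
  have hmeas : Measurable fun p : ℕ × (ℕ → Y) => ∏ k ∈ Finset.range p.1, g (p.2 k) :=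
    measurable_from_prod_countable_right fun n => by
      dsimp only
      fun_prop
  rw [layerLaw, lintegral_prod _ hmeas.aemeasurable, poissonMeasure, lintegral_sum_measure]
  refine tsum_congr fun n => ?_
  rw [lintegral_smul_measure, lintegral_dirac, smul_eq_mul]
  congr 1
  dsimp only
  have hind : iIndepFun (fun (k : ℕ) (ω : ℕ → Y) => g (ω k))
      (Measure.infinitePi fun _ : ℕ => ρ) := iIndepFun_infinitePi fun _ => hg
  rw [lintegral_prod_eq_prod_lintegral_of_indepFun _ (fun (k : ℕ) (ω : ℕ → Y) => g (ω k)) hind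
    (by fun_prop)]
  rw [Finset.prod_congr rfl fun k _ => ?_, Finset.prod_const, Finset.card_range]
  exact (measurePreserving_eval_infinitePi (fun _ : ℕ => ρ) k).lintegral_comp hg

theorem lintegral_layerLaw_exp {Y : Type*} [MeasurableSpace Y] (m : ℝ≥0) (ρ : Measure Y)
    [IsProbabilityMeasure ρ] {F : Y → ℝ} (hF : Measurable F)
    (hfin : ∫⁻ p, ENNReal.ofReal (Real.exp (∑ k ∈ Finset.range p.1, F (p.2 k)))
      ∂(layerLaw m ρ) ≠ ∞) :
    Integrable (fun y => Real.exp (F y) - 1) (m • ρ) ∧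
      ∫⁻ p, ENNReal.ofReal (Real.exp (∑ k ∈ Finset.range p.1, F (p.2 k))) ∂(layerLaw m ρ) =
        ENNReal.ofReal (Real.exp (∫ y, (Real.exp (F y) - 1) ∂(m • ρ))) := by
  have hg : Measurable fun y => ENNReal.ofReal (Real.exp (F y)) := by fun_prop
  simp only [Real.exp_sum, ENNReal.ofReal_prod_of_nonneg (fun _ _ => (Real.exp_pos _).le)]
    at hfin ⊢
  rw [lintegral_layerLaw_prod m ρ hg] at hfin ⊢
  rcases eq_or_ne m 0 with rfl | hm
  · refine ⟨by simp, ?_⟩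
    rw [tsum_eq_single 0]
    · simp
    · intro n hn; simp [hn]
  -- The term n = 1 of the finite series has positive Poisson weight, so it bounds the exponential
  -- moment of one point.
  have hc : ∫⁻ y, ENNReal.ofReal (Real.exp (F y)) ∂ρ ≠ ∞ := by
    intro h
    refine (ENNReal.ne_top_of_tsum_ne_top hfin 1) ?_
    rw [h, pow_one, pow_one, ENNReal.mul_top]
    have : (0 : ℝ) < m := by positivity
    simp only [ne_eq, ENNReal.ofReal_eq_zero, not_le]
    positivity
  have hint : Integrable (fun y => Real.exp (F y)) ρ := by
    refine ⟨by fun_prop, ?_⟩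
    rw [hasFiniteIntegral_iff_ofReal (ae_of_all _ fun _ => (Real.exp_pos _).le)]
    exact hc.lt_top
  refine ⟨(hint.sub (integrable_const 1)).smul_measure_nnreal, ?_⟩
  rw [← ofReal_integral_eq_lintegral_ofReal hint (ae_of_all _ fun _ => (Real.exp_pos _).le)]
  set c := ∫ y, Real.exp (F y) ∂ρ with hcdef
  have hc0 : 0 ≤ c := integral_nonneg fun _ => (Real.exp_pos _).le
  have e1 : ∫ y, (Real.exp (F y) - 1) ∂(m • ρ) = m * (c - 1) := by
    rw [integral_smul_nnreal_measure, integral_sub hint (integrable_const 1)]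
    simp [NNReal.smul_def, hcdef]
  have hs : HasSum (fun n : ℕ => Real.exp (-m) * m ^ n / n.factorial * c ^ n)
      (Real.exp (m * (c - 1))) := by
    have h := (NormedSpace.expSeries_div_hasSum_exp (𝔸 := ℝ) (m * c)).mul_left (Real.exp (-m))
    rw [← Real.exp_eq_exp_ℝ, ← Real.exp_add] at h
    convert! h using 1
    · ext n; rw [mul_pow]; ring
    · congr 1; ring
  rw [e1, ← hs.tsum_eq, ENNReal.ofReal_tsum_of_nonneg (fun n => by positivity) hs.summable]
  refine tsum_congr fun n => ?_
  rw [ENNReal.ofReal_mul (by positivity), ENNReal.ofReal_pow hc0]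

/-- Write e^S as a product of the first n factors and a remainder R n. By independence c = h n * r
n, where c = E e^S, h n is the finite product and r n = E R n. Fatou on the partial products gives c
≤ liminf h; Fatou on R n → 1 gives 1 ≤ liminf r, hence limsup h ≤ c. -/
theorem tendsto_prod_lintegral_exp {X : ℕ → Type*} [∀ j, MeasurableSpace (X j)]
    (μ : ∀ j, Measure (X j)) [∀ j, IsProbabilityMeasure (μ j)] {L : ∀ j, X j → ℝ}
    (hL : ∀ j, Measurable (L j)) {S : (∀ j, X j) → ℝ}
    (hS : ∀ᵐ ω ∂(Measure.infinitePi μ),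
      Tendsto (fun n => ∑ j ∈ Finset.range n, L j (ω j)) atTop (𝓝 (S ω)))
    (hfin : ∫⁻ ω, ENNReal.ofReal (Real.exp (S ω)) ∂(Measure.infinitePi μ) ≠ ∞) :
    ∫⁻ ω, ENNReal.ofReal (Real.exp (S ω)) ∂(Measure.infinitePi μ) ≠ 0 ∧
      (∀ j, ∫⁻ x, ENNReal.ofReal (Real.exp (L j x)) ∂(μ j) ≠ ∞) ∧
      Tendsto (fun n => ∏ j ∈ Finset.range n, ∫⁻ x, ENNReal.ofReal (Real.exp (L j x)) ∂(μ j)) atTop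
        (𝓝 (∫⁻ ω, ENNReal.ofReal (Real.exp (S ω)) ∂(Measure.infinitePi μ))) := by
  set P := Measure.infinitePi μ with hP
  set e : ℕ → (∀ j, X j) → ℝ≥0∞ := fun j ω => ENNReal.ofReal (Real.exp (L j (ω j))) with he
  set a : ℕ → ℝ≥0∞ := fun j => ∫⁻ x, ENNReal.ofReal (Real.exp (L j x)) ∂(μ j) with ha
  set c := ∫⁻ ω, ENNReal.ofReal (Real.exp (S ω)) ∂P with hc
  have hem : ∀ j, Measurable (e j) := fun j => by fun_prop
  have hprod : ∀ s : Finset ℕ, ∫⁻ ω, ∏ j ∈ s, e j ω ∂P = ∏ j ∈ s, a j := by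
    intro s
    have hind : iIndepFun e P :=
      iIndepFun_infinitePi (X := fun j (x : X j) => ENNReal.ofReal (Real.exp (L j x)))
        fun j => by fun_prop
    rw [lintegral_prod_eq_prod_lintegral_of_indepFun _ e hind hem]
    refine Finset.prod_congr rfl fun j _ => ?_
    exact (measurePreserving_eval_infinitePi μ j).lintegral_comp
      (f := fun x => ENNReal.ofReal (Real.exp (L j x))) (by fun_prop)
  have hprodexp : ∀ (s : Finset ℕ) (ω : ∀ j, X j),
      ∏ j ∈ s, e j ω = ENNReal.ofReal (Real.exp (∑ j ∈ s, L j (ω j))) := by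
    intro s ω
    rw [Real.exp_sum, ENNReal.ofReal_prod_of_nonneg fun _ _ => (Real.exp_pos _).le]
  -- The remainder is a liminf of finite products rather than exp(S - partial sum): it is then
  -- exactly measurable in the coordinates from n on, while S is known only almost everywhere.
  set R : ℕ → (∀ j, X j) → ℝ≥0∞ :=
    fun n ω => liminf (fun m => ∏ j ∈ Finset.Ico n m, e j ω) atTop with hR
  have hRm : ∀ n, Measurable (R n) := fun n => by
    refine Measurable.liminf fun m => ?_
    fun_prop
  have hRval : ∀ᵐ ω ∂P, ∀ n,
      R n ω = ENNReal.ofReal (Real.exp (S ω - ∑ j ∈ Finset.range n, L j (ω j))) := by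
    filter_upwards [hS] with ω hω n
    refine Tendsto.liminf_eq ?_
    have h1 : Tendsto (fun m => ∑ j ∈ Finset.range m, L j (ω j) - ∑ j ∈ Finset.range n, L j (ω j))
        atTop (𝓝 (S ω - ∑ j ∈ Finset.range n, L j (ω j))) := hω.sub_const _
    have h2 := ENNReal.tendsto_ofReal ((Real.continuous_exp.tendsto _).comp h1)
    refine h2.congr' ?_
    filter_upwards [eventually_ge_atTop n] with m hm
    rw [hprodexp, Finset.sum_Ico_eq_sub _ hm]
    rfl
  set h : ℕ → ℝ≥0∞ := fun n => ∏ j ∈ Finset.range n, a j with hh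
  set r : ℕ → ℝ≥0∞ := fun n => ∫⁻ ω, R n ω ∂P with hr
  have hmul : ∀ n, h n * r n = c := by
    intro n
    let m' : ℕ → MeasurableSpace (∀ j, X j) := fun j => MeasurableSpace.comap (fun ω => ω j)
      inferInstance
    have hle : ∀ j, m' j ≤ MeasurableSpace.pi := fun j => (measurable_pi_apply j).comap_le
    have hindep : iIndep m' P :=
      (iIndepFun_infinitePi (P := μ) (X := fun j (x : X j) => x) fun j => measurable_id)
    have hdisj : Disjoint {j | j < n} {j | n ≤ j} := by
      rw [Set.disjoint_left]
      intro j h1 h2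
      simp only [Set.mem_ofPred_eq] at h1 h2
      omega
    have hI := indep_iSup_of_disjoint hle hindep hdisj
    have hcomp : ∀ j, Measurable[m' j] (e j) := fun j =>
      (show Measurable fun x : X j => ENNReal.ofReal (Real.exp (L j x)) by fun_prop).comp
        (comap_measurable _)
    have key := lintegral_mul_eq_lintegral_mul_lintegral_of_independent_measurableSpace
      (f := fun ω => ∏ j ∈ Finset.range n, e j ω) (g := R n)
      (iSup₂_le fun j _ => hle j) (iSup₂_le fun j _ => hle j) hI
      (Finset.measurable_prod _ fun j hj =>
        (hcomp j).mono (le_iSup₂_of_le j (Finset.mem_range.1 hj) le_rfl) le_rfl)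
      (Measurable.liminf fun m => Finset.measurable_prod _ fun j hj =>
        (hcomp j).mono (le_iSup₂_of_le j (Finset.mem_Ico.1 hj).1 le_rfl) le_rfl)
    rw [hprod] at key
    rw [hh, hr, ← key]
    refine lintegral_congr_ae ?_
    filter_upwards [hRval] with ω hω
    rw [hω, hprodexp, ← ENNReal.ofReal_mul (Real.exp_pos _).le, ← Real.exp_add]
    congr 2; ring
  have hSm : AEMeasurable S P :=
    aemeasurable_of_tendsto_metrizable_ae' (fun n =>
      (Finset.measurable_fun_sum _ fun j _ => (hL j).comp (measurable_pi_apply j)).aemeasurable) hS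
  have hc0 : c ≠ 0 := by
    intro h0
    rw [hc, lintegral_eq_zero_iff' (by fun_prop)] at h0
    obtain ⟨ω, hω⟩ := h0.exists
    simp only [Pi.zero_apply, ENNReal.ofReal_eq_zero] at hω
    exact absurd (Real.exp_pos (S ω)) (not_lt.2 hω)
  have hr0 : ∀ n, r n ≠ 0 := fun n h0 => hc0 (by rw [← hmul n, h0, mul_zero])
  have hh0 : ∀ n, h n ≠ 0 := fun n h0 => hc0 (by rw [← hmul n, h0, zero_mul])
  have hhtop : ∀ n, h n ≠ ∞ := fun n h1 => hfin (by
    rw [← hmul n, h1, ENNReal.top_mul (hr0 n)])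
  have hrtop : ∀ n, r n ≠ ∞ := fun n h1 => hfin (by
    rw [← hmul n, h1, ENNReal.mul_top (hh0 n)])
  have hheq : ∀ n, h n = c * (r n)⁻¹ := fun n => by
    rw [← hmul n, mul_assoc, ENNReal.mul_inv_cancel (hr0 n) (hrtop n), mul_one]
  have hr1 : 1 ≤ liminf r atTop := by
    refine le_trans ?_ (lintegral_liminf_le hRm)
    rw [show (1 : ℝ≥0∞) = ∫⁻ _, 1 ∂P by simp]
    refine lintegral_mono_ae ?_
    filter_upwards [hRval, hS] with ω hω hSω
    refine le_of_eq (Tendsto.liminf_eq ?_).symm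
    simp only [hω]
    have h1 : Tendsto (fun n => S ω - ∑ j ∈ Finset.range n, L j (ω j)) atTop (𝓝 0) := by
      simpa using hSω.const_sub (S ω)
    have h2 := ENNReal.tendsto_ofReal ((Real.continuous_exp.tendsto _).comp h1)
    simpa using h2
  have hclim : c ≤ liminf h atTop := by
    have e1 : h = fun n => ∫⁻ ω, ∏ j ∈ Finset.range n, e j ω ∂P := by
      ext n; rw [hprod]
    rw [e1]
    refine le_trans ?_ (lintegral_liminf_le fun n => by fun_prop)
    refine lintegral_mono_ae ?_
    filter_upwards [hS] with ω hω
    refine le_of_eq (Tendsto.liminf_eq ?_).symm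
    simp only [hprodexp]
    exact ENNReal.tendsto_ofReal ((Real.continuous_exp.tendsto _).comp hω)
  have hsup : limsup h atTop ≤ c := by
    have e1 : h = fun n => c * (r n)⁻¹ := by ext n; exact hheq n
    rw [e1, ENNReal.limsup_const_mul_of_ne_top hfin]
    have e2 : limsup (fun n => (r n)⁻¹) atTop = (liminf r atTop)⁻¹ := by
      rw [ENNReal.inv_liminf]
    rw [e2]
    calc c * (liminf r atTop)⁻¹ ≤ c * 1⁻¹ := by gcongr
      _ = c := by simp
  refine ⟨hc0, fun j hj => ?_, tendsto_of_le_liminf_of_limsup_le hclim hsup⟩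
  have h1 : h (j + 1) = h j * a j := Finset.prod_range_succ _ _
  rw [ha] at h1
  dsimp only at h1
  rw [hj, ENNReal.mul_top (hh0 j)] at h1
  exact hhtop _ h1

/-- The law of a sample with independent layers. -/
noncomputable def layeredLaw {Y : Type*} [MeasurableSpace Y] (m : ℕ → ℝ≥0) (ρ : ℕ → Measure Y) :
    Measure (Sample Y) :=
  Measure.infinitePi fun j => layerLaw (m j) (ρ j)

instance {Y : Type*} [MeasurableSpace Y] (m : ℕ → ℝ≥0) (ρ : ℕ → Measure Y)
    [∀ j, IsProbabilityMeasure (ρ j)] : IsProbabilityMeasure (layeredLaw m ρ) := by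
  unfold layeredLaw
  infer_instance

open Classical in
/-- The value of `F` at the point with label `i`, and `0` if there is no such point. -/
noncomputable def Sample.eval {Y : Type*} (F : Y → ℝ) (s : Sample Y) (i : ℕ × ℕ) : ℝ :=
  if s.Occurs i then F (s.point i) else 0

theorem tendsto_sum_layers {Y : Type*} {F : Y → ℝ} {s : Sample Y} (h : Summable (s.eval F)) :
    Tendsto (fun n => ∑ j ∈ Finset.range n, ∑ k ∈ Finset.range (s j).1, F ((s j).2 k)) atTop
      (𝓝 (∑' i, s.eval F i)) := by
  refine (HasSum.prod_fiberwise h.hasSum fun j => ?_).tendsto_sum_nat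
  have h1 : ∑ k ∈ Finset.range (s j).1, F ((s j).2 k) =
      ∑ k ∈ Finset.range (s j).1, s.eval F (j, k) := by
    refine Finset.sum_congr rfl fun k hk => ?_
    rw [Sample.eval, if_pos (show s.Occurs (j, k) from Finset.mem_range.1 hk)]
    rfl
  rw [h1]
  refine hasSum_sum_of_ne_finset_zero fun k hk => ?_
  rw [Sample.eval, if_neg]
  exact fun h => hk (Finset.mem_range.2 h)

theorem measurable_layer_sum {Y : Type*} [MeasurableSpace Y] {F : Y → ℝ} (hF : Measurable F) :
    Measurable fun p : ℕ × (ℕ → Y) => ∑ k ∈ Finset.range p.1, F (p.2 k) :=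
  measurable_from_prod_countable_right fun n => by
    dsimp only
    fun_prop

theorem layeredLaw_tendsto {Y : Type*} [MeasurableSpace Y] (m : ℕ → ℝ≥0) (ρ : ℕ → Measure Y)
    [∀ j, IsProbabilityMeasure (ρ j)] {F : Y → ℝ} (hF : Measurable F)
    (hs : ∀ᵐ s ∂(layeredLaw m ρ), Summable (s.eval F))
    (hfin : ∫⁻ s, ENNReal.ofReal (Real.exp (∑' i, s.eval F i)) ∂(layeredLaw m ρ) ≠ ∞) :
    ∫⁻ s, ENNReal.ofReal (Real.exp (∑' i, s.eval F i)) ∂(layeredLaw m ρ) ≠ 0 ∧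
      (∀ j, Integrable (fun y => Real.exp (F y) - 1) (m j • ρ j)) ∧
      Tendsto (fun n => ENNReal.ofReal (Real.exp
          (∑ j ∈ Finset.range n, ∫ y, (Real.exp (F y) - 1) ∂(m j • ρ j)))) atTop
        (𝓝 (∫⁻ s, ENNReal.ofReal (Real.exp (∑' i, s.eval F i)) ∂(layeredLaw m ρ))) := by
  obtain ⟨h0, h1, h2⟩ := tendsto_prod_lintegral_exp (fun j => layerLaw (m j) (ρ j))
    (L := fun _ p => ∑ k ∈ Finset.range p.1, F (p.2 k)) (fun _ => measurable_layer_sum hF)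
    (S := fun s : Sample Y => ∑' i, s.eval F i) (hs.mono fun s h => tendsto_sum_layers h) hfin
  refine ⟨h0, fun j => (lintegral_layerLaw_exp _ _ hF (h1 j)).1, h2.congr fun n => ?_⟩
  rw [Real.exp_sum, ENNReal.ofReal_prod_of_nonneg fun _ _ => (Real.exp_pos _).le]
  exact Finset.prod_congr rfl fun j _ => (lintegral_layerLaw_exp _ _ hF (h1 j)).2

/-- The exponential formula for a Poisson sample. -/
theorem layeredLaw_exp {Y : Type*} [MeasurableSpace Y] (m : ℕ → ℝ≥0) (ρ : ℕ → Measure Y)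
    [∀ j, IsProbabilityMeasure (ρ j)] {F : Y → ℝ} (hF : Measurable F)
    (hs : ∀ᵐ s ∂(layeredLaw m ρ), Summable (s.eval F))
    (hint : Integrable (fun s => Real.exp (∑' i, s.eval F i)) (layeredLaw m ρ)) :
    Integrable (fun y => Real.exp (F y) - 1) (Measure.sum fun j => m j • ρ j) ∧
      ∫ s, Real.exp (∑' i, s.eval F i) ∂(layeredLaw m ρ) =
        Real.exp (∫ y, (Real.exp (F y) - 1) ∂(Measure.sum fun j => m j • ρ j)) := by
  have hpos : 0 < ∫ s, Real.exp (∑' i, s.eval F i) ∂(layeredLaw m ρ) := integral_exp_pos hint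
  have logtend : ∀ {u : ℕ → ℝ} {c : ℝ}, 0 < c →
      Tendsto (fun n => ENNReal.ofReal (Real.exp (u n))) atTop (𝓝 (ENNReal.ofReal c)) →
      Tendsto u atTop (𝓝 (Real.log c)) := by
    intro u c hc h
    have h1 := (ENNReal.tendsto_toReal ENNReal.ofReal_ne_top).comp h
    simp only [Function.comp_def, ENNReal.toReal_ofReal (Real.exp_pos _).le,
      ENNReal.toReal_ofReal hc.le] at h1
    simpa using h1.log hc.ne'
  have hlint := ofReal_integral_eq_lintegral_ofReal hint (ae_of_all _ fun _ => (Real.exp_pos _).le)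
  obtain ⟨-, hFint, hFt⟩ := layeredLaw_tendsto m ρ hF hs (hlint ▸ ENNReal.ofReal_ne_top)
  rw [← hlint] at hFt
  replace hFt := logtend hpos hFt
  -- the negative part is controlled by the formula for `-|F|`
  have heval : ∀ s : Sample Y, s.eval (fun y => -|F y|) = fun i => -|s.eval F i| := by
    intro s
    ext i
    unfold Sample.eval
    split_ifs <;> simp
  have hsG : ∀ᵐ s ∂(layeredLaw m ρ), Summable (s.eval fun y => -|F y|) :=
    hs.mono fun s h => by rw [heval]; exact h.abs.neg
  have hle1 : ∀ s : Sample Y, Real.exp (∑' i, s.eval (fun y => -|F y|) i) ≤ 1 := fun s => by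
    rw [heval, Real.exp_le_one_iff]
    exact tsum_nonpos fun i => neg_nonpos.2 (abs_nonneg _)
  have hfinG : ∫⁻ s, ENNReal.ofReal (Real.exp (∑' i, s.eval (fun y => -|F y|) i))
      ∂(layeredLaw m ρ) ≤ 1 := by
    calc _ ≤ ∫⁻ _, 1 ∂(layeredLaw m ρ) :=
          lintegral_mono fun s => ENNReal.ofReal_le_one.2 (hle1 s)
      _ = 1 := by simp
  have hntG := ne_top_of_le_ne_top ENNReal.one_ne_top hfinG
  obtain ⟨hposG, hGint, hGt⟩ := layeredLaw_tendsto m ρ (F := fun y => -|F y|) (by fun_prop) hsG hntG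
  rw [← ENNReal.ofReal_toReal hntG] at hGt
  replace hGt := logtend (ENNReal.toReal_pos hposG hntG) hGt
  -- The factor 2 makes this an equality where F ≤ 0; where F ≥ 0 the subtracted term is
  -- nonpositive.
  have hbound : ∀ y, |Real.exp (F y) - 1| ≤
      (Real.exp (F y) - 1) - 2 * (Real.exp (-|F y|) - 1) := by
    intro y
    rcases le_total 0 (F y) with h | h
    · have h1 : 1 ≤ Real.exp (F y) := Real.one_le_exp h
      have h2 : Real.exp (-|F y|) ≤ 1 := Real.exp_le_one_iff.2 (neg_nonpos.2 (abs_nonneg _))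
      rw [abs_of_nonneg (by linarith)]
      linarith
    · have h1 : Real.exp (F y) ≤ 1 := Real.exp_le_one_iff.2 h
      rw [abs_of_nonpos (by linarith), abs_of_nonpos h, neg_neg]
      linarith
  -- Convergence of both sequences of partial sums bounds the partial sums of the integrals of |e^F
  -- - 1|.
  have hlim := hFt.sub (hGt.const_mul 2)
  obtain ⟨B, hB⟩ := hlim.bddAbove_range
  have hsum : Summable fun j => ∫ y, |Real.exp (F y) - 1| ∂(m j • ρ j) := by
    refine summable_of_sum_range_le (c := B) (fun j => integral_nonneg fun _ => abs_nonneg _)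
      fun n => le_trans ?_ (hB ⟨n, rfl⟩)
    dsimp only
    rw [Finset.mul_sum, ← Finset.sum_sub_distrib]
    refine Finset.sum_le_sum fun j _ => ?_
    rw [← integral_const_mul, ← integral_sub (hFint j) ((hGint j).const_mul 2)]
    exact integral_mono (hFint j).abs ((hFint j).sub ((hGint j).const_mul 2)) hbound
  have hI : Integrable (fun y => Real.exp (F y) - 1) (Measure.sum fun j => m j • ρ j) :=
    integrable_sum_measure hFint hsum
  refine ⟨hI, ?_⟩
  rw [← Real.exp_log hpos, tendsto_nhds_unique hFt (hasSum_integral_measure hI).tendsto_sum_nat]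

/-- A layer of nonzero mean has exactly one point with positive probability, and the location of
that point is independent of the count with law `ρ j`. A property of all points therefore holds `ρ
j`-almost everywhere. -/
theorem ae_of_forall_occurs {Y : Type*} [MeasurableSpace Y] (m : ℕ → ℝ≥0) (ρ : ℕ → Measure Y)
    [∀ j, IsProbabilityMeasure (ρ j)] {p : Y → Prop} (hp : MeasurableSet {y | p y})
    (h : ∀ᵐ s ∂(layeredLaw m ρ), ∀ i, s.Occurs i → p (s.point i)) :
    ∀ᵐ y ∂(Measure.sum fun j => m j • ρ j), p y := by
  change (Measure.sum fun j => m j • ρ j) {y | p y}ᶜ = 0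
  rw [Measure.sum_apply _ hp.compl, ENNReal.tsum_eq_zero]
  intro j
  have h1 : ∀ᵐ q ∂(layerLaw (m j) (ρ j)), 0 < q.1 → p (q.2 0) := by
    rw [← Measure.infinitePi_map_eval (fun j => layerLaw (m j) (ρ j)) j]
    refine (ae_map_iff (f := fun x : Sample Y => x j) (measurable_pi_apply j).aemeasurable ?_).2 ?_
    rotate_left
    · exact h.mono fun s hs => hs (j, 0)
    · have e : {q : ℕ × (ℕ → Y) | 0 < q.1 → p (q.2 0)} =
          {q | 0 < q.1}ᶜ ∪ (fun q => q.2 0) ⁻¹' {y | p y} := by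
        ext q; simp [imp_iff_not_or]
      rw [e]
      have hm : Measurable fun q : ℕ × (ℕ → Y) => q.2 0 := by fun_prop
      exact ((measurable_fst (MeasurableSet.of_discrete (s := {n : ℕ | 0 < n}))).compl).union
        (hm hp)
  have h2 : (layerLaw (m j) (ρ j)) ({1} ×ˢ ((fun x : ℕ → Y => x 0) ⁻¹' {y | p y}ᶜ)) = 0 := by
    refine measure_mono_null ?_ (ae_iff.1 h1)
    rintro ⟨n, x⟩ ⟨hn, hx⟩
    simp only [Set.mem_singleton_iff] at hn
    subst hn
    simpa using hx
  have h3 : (Measure.infinitePi fun _ : ℕ => ρ j) ((fun x : ℕ → Y => x 0) ⁻¹' {y | p y}ᶜ) =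
      ρ j {y | p y}ᶜ :=
    (measurePreserving_eval_infinitePi (fun _ : ℕ => ρ j) 0).measure_preimage
      hp.compl.nullMeasurableSet
  rw [layerLaw, Measure.prod_prod, poissonMeasure_singleton, h3, mul_eq_zero] at h2
  rcases h2 with h2 | h2
  · have h4 : m j = 0 := by
      by_contra hm
      have : (0 : ℝ) < m j := by positivity
      rw [ENNReal.ofReal_eq_zero] at h2
      exact absurd h2 (not_le.2 (by positivity))
    simp [h4]
  · change (m j • ρ j) {y | p y}ᶜ = 0
    simp [h2]

/-! ### Marking a Poisson sample -/

/-- A sample of marked points, as a sample of points and a family of marks. -/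
def unbundle {E T : Type*} (s : Sample (E × T)) : Sample E × (ℕ × ℕ → T) :=
  (fun j => ((s j).1, fun k => ((s j).2 k).1), fun i => ((s i.1).2 i.2).2)

theorem measurable_unbundle {E T : Type*} [MeasurableSpace E] [MeasurableSpace T] :
    Measurable (unbundle : Sample (E × T) → Sample E × (ℕ × ℕ → T)) := by
  unfold unbundle
  fun_prop

theorem layerLaw_map_unzip {E T : Type*} [MeasurableSpace E] [MeasurableSpace T] (m : ℝ≥0)
    (ρ : Measure E) (κ : Measure T) [IsProbabilityMeasure ρ] [IsProbabilityMeasure κ] :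
    (layerLaw m (ρ.prod κ)).map
        (fun p => ((p.1, fun k => (p.2 k).1), fun k => (p.2 k).2)) =
      (layerLaw m ρ).prod (Measure.infinitePi fun _ : ℕ => κ) := by
  have h1 := infinitePi_map_unzip (fun _ : ℕ => ρ) (fun _ : ℕ => κ)
  have h2 := Measure.map_prod_map (poissonMeasure m) (Measure.infinitePi fun _ : ℕ => ρ.prod κ)
    measurable_id (g := fun p : ℕ → E × T => (fun i => (p i).1, fun i => (p i).2)) (by fun_prop)
  rw [h1, Measure.map_id] at h2
  rw [layerLaw, layerLaw, ← (measurePreserving_prodAssoc (poissonMeasure m)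
    (Measure.infinitePi fun _ : ℕ => ρ) (Measure.infinitePi fun _ : ℕ => κ)).symm.map_eq, h2,
    Measure.map_map (by fun_prop) (by fun_prop)]
  rfl

/-- The marking theorem: independent marks attached to all labels, occurring or not, amount to
replacing each location law by its product with the mark law. -/
theorem sampleLaw_prod_eq {E T : Type*} [MeasurableSpace E] [Zero E] [MeasurableSpace T]
    (ν : Measure E) [SFinite ν] (κ : Measure T) [IsProbabilityMeasure κ] :
    (sampleLaw ν).prod (Measure.infinitePi fun _ : ℕ × ℕ => κ) =
      (layeredLaw (fun j => (sfiniteSeq ν j Set.univ).toNNReal)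
        (fun j => (normalized (sfiniteSeq ν j)).prod κ)).map unbundle := by
  have h1 := Measure.infinitePi_map_pi
    (fun j => layerLaw (sfiniteSeq ν j Set.univ).toNNReal ((normalized (sfiniteSeq ν j)).prod κ))
    (f := fun _ p => (((p.1, fun k => (p.2 k).1), fun k => (p.2 k).2) : (ℕ × (ℕ → E)) × (ℕ → T)))
    fun _ => by fun_prop
  simp only [layerLaw_map_unzip] at h1
  have h2 := infinitePi_map_unzip
    (fun j => layerLaw (sfiniteSeq ν j Set.univ).toNNReal (normalized (sfiniteSeq ν j)))
    (fun _ => Measure.infinitePi fun _ : ℕ => κ)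
  rw [← h1, Measure.map_map (by fun_prop) (by fun_prop)] at h2
  -- Marks indexed by pairs (j, k) are regrouped layer by layer.
  have h3 := Measure.map_prod_map (sampleLaw ν)
    (Measure.infinitePi fun _ : ℕ => Measure.infinitePi fun _ : ℕ => κ) measurable_id
    (MeasurableEquiv.curry ℕ ℕ T).symm.measurable
  rw [Measure.infinitePi_map_curry_symm (fun _ _ => κ), Measure.map_id] at h3
  rw [h3]
  change (((Measure.infinitePi fun j => layerLaw (sfiniteSeq ν j Set.univ).toNNReal
    (normalized (sfiniteSeq ν j))).prod _).map _) = _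
  rw [← h2, Measure.map_map (by fun_prop) (by fun_prop)]
  rfl

theorem toNNReal_smul_normalized {E : Type*} [MeasurableSpace E] [Zero E] (μ : Measure E)
    [IsFiniteMeasure μ] : (μ Set.univ).toNNReal • normalized μ = μ := by
  unfold normalized
  split_ifs with h
  · simp [h]
  · change ((μ Set.univ).toNNReal : ℝ≥0∞) • ((μ Set.univ)⁻¹ • μ) = μ
    rw [smul_smul, ENNReal.coe_toNNReal (measure_ne_top μ _),
      ENNReal.mul_inv_cancel (by simpa using h) (measure_ne_top μ _), one_smul]

theorem sum_smul_normalized_prod {E T : Type*} [MeasurableSpace E] [Zero E] [MeasurableSpace T]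
    (ν : Measure E) [SFinite ν] (κ : Measure T) [IsProbabilityMeasure κ] :
    (Measure.sum fun j => (sfiniteSeq ν j Set.univ).toNNReal •
      (normalized (sfiniteSeq ν j)).prod κ) = ν.prod κ := by
  conv_rhs => rw [← sum_sfiniteSeq ν, Measure.prod_sum_left]
  congr 1
  ext1 j
  conv_rhs => rw [← toNNReal_smul_normalized (sfiniteSeq ν j)]
  exact (Measure.prod_smul_left _).symm

/-- The Bochner integral is a difference of lower integrals on the measurable set where f is
integrable, and the default value 0 elsewhere. -/
theorem measurable_integral_measure {E : Type*} [MeasurableSpace E] {f : E → ℝ}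
    (hf : Measurable f) : Measurable fun η : Measure E => ∫ x, f x ∂η := by
  classical
  have h : (fun η : Measure E => ∫ x, f x ∂η) = fun η : Measure E =>
      if ∫⁻ x, ‖f x‖ₑ ∂η < ∞ then
        (∫⁻ x, ENNReal.ofReal (f x) ∂η).toReal - (∫⁻ x, ENNReal.ofReal (-f x) ∂η).toReal
      else 0 := by
    ext η
    split_ifs with hi
    · exact integral_eq_lintegral_pos_part_sub_lintegral_neg_part
        ⟨hf.aestronglyMeasurable, hi⟩
    · exact integral_undef fun h => hi h.2
  rw [h]
  refine Measurable.ite (measurableSet_lt (Measure.measurable_lintegral hf.enorm)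
    measurable_const) ?_ measurable_const
  exact (Measure.measurable_lintegral hf.ennreal_ofReal).ennreal_toReal.sub
    (Measure.measurable_lintegral hf.neg.ennreal_ofReal).ennreal_toReal

theorem measurableSet_integrable_measure {E : Type*} [MeasurableSpace E] {f : E → ℝ}
    (hf : Measurable f) : MeasurableSet {η : Measure E | Integrable f η} := by
  have h : {η : Measure E | Integrable f η} = {η : Measure E | ∫⁻ x, ‖f x‖ₑ ∂η < ∞} := by
    ext η
    exact ⟨fun h => h.2, fun h => ⟨hf.aestronglyMeasurable, h⟩⟩
  rw [h]
  exact measurableSet_lt (Measure.measurable_lintegral hf.enorm) measurable_const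

/-! ### Decomposition of the family tree at the ancestor -/

section Cluster

variable {E : Type*} [MeasurableSpace E]

open Classical in
/-- The point measure of the cluster with ancestor at `z` and family tree `T`. -/
noncomputable def clusterAt [AddZeroClass E] (y : E × Tree E) : Measure E :=
  Measure.sum fun u : Node => if y.2.Born u then Measure.dirac (y.1 + y.2.pos u) else 0

theorem dirac_add_map_progeny [AddMonoid E] [MeasurableAdd₂ E] (z : E) (T : Tree E) :
    Measure.dirac z + (progeny T).map (fun x => z + x) = clusterAt (z, T) := by
  classical
  have hm : Measurable fun x : E => z + x := measurable_const.add measurable_id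
  ext A hA
  rw [Measure.add_apply, Measure.map_apply hm hA, progeny, clusterAt, Measure.sum_apply _ (hm hA),
    Measure.sum_apply _ hA]
  conv_rhs => rw [ENNReal.tsum_eq_add_tsum_ite ([] : Node)]
  congr 1
  · simp [Tree.Born, Tree.pos]
  · refine tsum_congr fun u => ?_
    by_cases hu : u = []
    · simp [hu]
    · by_cases hb : T.Born u
      · simp only [hu, hb, ne_eq, not_false_eq_true, and_self, if_true, if_false]
        rw [Measure.dirac_apply' _ (hm hA), Measure.dirac_apply' _ hA]
        rfl
      · simp [hu, hb]

theorem measurable_clusterAt [AddZeroClass E] [MeasurableAdd₂ E] :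
    Measurable (clusterAt : E × Tree E → Measure E) := by
  classical
  refine Measure.measurable_of_measurable_coe _ fun A hA => ?_
  simp only [clusterAt, Measure.sum_apply _ hA]
  refine Measurable.tsum fun u => (Measure.measurable_coe hA).comp
    (Measurable.ite (measurable_snd (measurableSet_born u)) ?_ measurable_const)
  exact Measure.measurable_dirac.comp
    (measurable_fst.add ((measurable_pos u).comp measurable_snd))

/-- The family tree of the child with label `c` of the ancestor. -/
def Tree.subtree {E : Type*} (T : Tree E) (c : ℕ × ℕ) : Tree E := fun u => T (u ++ [c])

/-- Labels grow at the head, so the last entry names the child of the ancestor from which an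
individual descends. -/
theorem Tree.born_append {E : Type*} (T : Tree E) (c : ℕ × ℕ) (u : Node) :
    T.Born (u ++ [c]) ↔ (T []).Occurs c ∧ (T.subtree c).Born u := by
  induction u with
  | nil => simp [Tree.Born]
  | cons b u ih =>
    simp only [List.cons_append, Tree.Born, ih, and_assoc]
    rfl

theorem Tree.pos_append {E : Type*} [AddMonoid E] (T : Tree E) (c : ℕ × ℕ) (u : Node) :
    T.pos (u ++ [c]) = (T []).point c + (T.subtree c).pos u := by
  induction u with
  | nil => simp [Tree.pos]
  | cons b u ih =>
    simp only [List.cons_append, Tree.pos, ih, add_assoc]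
    rfl

open Classical in
theorem cascade_eq_sum_clusterAt [AddMonoid E] [MeasurableAdd₂ E]
    (ω : Sample E × (ℕ × ℕ → Tree E)) :
    cascade ω = Measure.sum fun i : ℕ × ℕ =>
      if ω.1.Occurs i then clusterAt (ω.1.point i, ω.2 i) else 0 := by
  simp only [cascade, dirac_add_map_progeny]

/-- Every nonempty label is uniquely `u ++ [c]`, so the descendants split into the clusters of the
children of the ancestor. -/
theorem progeny_eq_cascade [AddMonoid E] [MeasurableAdd₂ E] (T : Tree E) :
    progeny T = cascade (T [], T.subtree) := by
  classical
  rw [cascade_eq_sum_clusterAt]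
  ext A hA
  rw [progeny, Measure.sum_apply _ hA, Measure.sum_apply _ hA]
  have hinj : Function.Injective fun p : (ℕ × ℕ) × Node => p.2 ++ [p.1] := by
    rintro ⟨c, u⟩ ⟨c', u'⟩ h
    simpa [and_comm] using h
  rw [← hinj.tsum_eq]
  · refine (ENNReal.tsum_prod (f := fun (c : ℕ × ℕ) (u : Node) =>
      (if u ++ [c] ≠ [] ∧ T.Born (u ++ [c]) then Measure.dirac (T.pos (u ++ [c])) else 0) A)).trans ?_
    refine tsum_congr fun c => ?_
    by_cases hc : (T []).Occurs c
    · simp [Tree.born_append, Tree.pos_append, hc, clusterAt, Measure.sum_apply _ hA]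
    · simp [Tree.born_append, hc]
  · intro u hu
    rcases List.eq_nil_or_concat' u with rfl | ⟨v, c, rfl⟩
    · simp at hu
    · exact ⟨(c, v), rfl⟩

/-- The σ-algebra on Ω is left free so that it can be the one generated by the samples of the
non-root nodes. -/
theorem measurable_subtree_comp {Ω : Type*} [MeasurableSpace Ω] {X : Ω → Tree E}
    (hX : ∀ u : Node, u ≠ [] → Measurable fun ω => X ω u) : Measurable fun ω => (X ω).subtree :=
  measurable_pi_iff.2 fun c => measurable_pi_iff.2 fun u => hX (u ++ [c]) (by simp)

/-- The subtrees use no sample of the root, which gives independence from it; distinct pairs (c, u)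
use distinct nodes, so the subtrees are independent copies of the tree. -/
theorem treeLaw_map_subtree [Zero E] (γ : Measure E) [SFinite γ] :
    (treeLaw γ).map (fun T => (T [], T.subtree)) =
      (sampleLaw γ).prod (Measure.infinitePi fun _ : ℕ × ℕ => treeLaw γ) := by
  let m' : Node → MeasurableSpace (Tree E) := fun u => MeasurableSpace.comap (fun T => T u)
    inferInstance
  have hle : ∀ u, m' u ≤ MeasurableSpace.pi := fun u => (measurable_pi_apply u).comap_le
  have hindep : iIndep m' (treeLaw γ) :=
    (iIndepFun_infinitePi (P := fun _ : Node => sampleLaw γ)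
      (X := fun _ (x : Sample E) => x) fun _ => measurable_id)
  have hI := indep_iSup_of_disjoint hle hindep (S := {[]}) (T := {u | u ≠ []}) (by simp)
  have hsub : Measurable fun T : Tree E => T.subtree := by
    unfold Tree.subtree
    fun_prop
  have h1 : IndepFun (fun T : Tree E => T []) (fun T : Tree E => T.subtree) (treeLaw γ) := by
    refine indep_of_indep_of_le_left (indep_of_indep_of_le_right hI ?_) ?_
    · exact (@measurable_subtree_comp E _ _ (⨆ u ∈ {u : Node | u ≠ []}, m' u) (fun T => T) fun u hu =>
        (comap_measurable (fun T : Tree E => T u)).mono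
          (le_iSup₂_of_le (f := fun u _ => m' u) u hu le_rfl) le_rfl).comap_le
    · exact le_iSup₂_of_le (f := fun u _ => m' u) [] (by simp) le_rfl
  rw [(indepFun_iff_map_prod_eq_prod_map_map
    (measurable_pi_apply ([] : Node)).aemeasurable hsub.aemeasurable).1 h1]
  congr 1
  · exact Measure.infinitePi_map_eval (fun _ : Node => sampleLaw γ) []
  · have hinj : Function.Injective fun p : (ℕ × ℕ) × Node => p.2 ++ [p.1] := by
      rintro ⟨c, u⟩ ⟨c', u'⟩ h
      simpa [and_comm] using h
    have h2 := Measure.map_infinitePi_infinitePi_of_inj (P := fun _ : Node => sampleLaw γ) hinj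
    have h3 := Measure.infinitePi_map_curry (ι := ℕ × ℕ) (κ := Node) fun _ _ => sampleLaw γ
    rw [← h2, Measure.map_map (by fun_prop) (by fun_prop)] at h3
    exact h3

theorem progenyLaw_eq_hawkesLaw [AddMonoid E] [MeasurableAdd₂ E] (γ : Measure E) [SFinite γ] :
    progenyLaw γ = hawkesLaw γ γ := by
  have hsub : Measurable fun T : Tree E => (T [], T.subtree) := by
    unfold Tree.subtree
    fun_prop
  rw [hawkesLaw, ← treeLaw_map_subtree, Measure.map_map measurable_cascade hsub, progenyLaw]
  congr 1
  ext1 T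
  exact progeny_eq_cascade T

end Cluster

/-! ### From products over atoms to exponentials of integrals -/

section Atomic


/-- The set where `|f|` is at least `1 / (n + 1)`. -/
def levelSet {E : Type*} (f : E → ℝ) (n : ℕ) : Set E := {x | 1 / ((n : ℝ) + 1) ≤ ‖f x‖}

theorem measurableSet_levelSet {E : Type*} [MeasurableSpace E] {f : E → ℝ} (hf : Measurable f)
    (n : ℕ) : MeasurableSet (levelSet f n) :=
  measurableSet_le measurable_const hf.norm

theorem exists_mem_levelSet {E : Type*} {f : E → ℝ} {x : E} (hx : f x ≠ 0) :
    ∃ n, x ∈ levelSet f n := by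
  obtain ⟨n, hn⟩ := exists_nat_one_div_lt (norm_pos_iff.2 hx)
  exact ⟨n, hn.le⟩

/-- On every set where `|f|` is bounded below, the basic open sets have measure `0` or at least
`1`. This is a measurable property of `η`, satisfied by all point measures. -/
def IsAtomicFor {E : Type*} [MeasurableSpace E] [TopologicalSpace E] [SecondCountableTopology E]
    (f : E → ℝ) (η : Measure E) : Prop :=
  ∀ n : ℕ, ∀ b ∈ TopologicalSpace.countableBasis E,
    η (b ∩ levelSet f n) = 0 ∨ 1 ≤ η (b ∩ levelSet f n)

theorem measure_sum_zero_or_one_le {E ι : Type*} [MeasurableSpace E] {η : ι → Measure E}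
    (h : ∀ i, ∀ A, MeasurableSet A → η i A = 0 ∨ 1 ≤ η i A) :
    ∀ A, MeasurableSet A → Measure.sum η A = 0 ∨ 1 ≤ Measure.sum η A := by
  intro A hA
  rw [Measure.sum_apply _ hA, ENNReal.tsum_eq_zero, or_iff_not_imp_left]
  intro h0
  push Not at h0
  obtain ⟨i, hi⟩ := h0
  exact ((h i A hA).resolve_left hi).trans (ENNReal.le_tsum i)

variable {E : Type*} [MeasurableSpace E] [TopologicalSpace E]
  [SecondCountableTopology E]

theorem measurableSet_isAtomicFor [OpensMeasurableSpace E] {f : E → ℝ} (hf : Measurable f) :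
    MeasurableSet {η : Measure E | IsAtomicFor f η} := by
  simp only [IsAtomicFor, Set.ofPred_forall]
  refine MeasurableSet.iInter fun n =>
    MeasurableSet.biInter (TopologicalSpace.countable_countableBasis E) fun b hb => ?_
  have hm : Measurable fun η : Measure E => η (b ∩ levelSet f n) :=
    Measure.measurable_coe ((TopologicalSpace.isOpen_of_mem_countableBasis hb).measurableSet.inter
      (measurableSet_levelSet hf n))
  exact (hm (measurableSet_singleton 0)).union (hm measurableSet_Ici)

/-- Integrability makes η finite on each level set. There a non-atom has, by outer regularity, a
basic neighbourhood of mass less than 1, hence of mass 0; countably many of these cover all the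
non-atoms. -/
theorem ae_singleton_ne_zero [TopologicalSpace.PseudoMetrizableSpace E] [BorelSpace E]
    {f : E → ℝ} (hf : Measurable f) {η : Measure E} (hη : Integrable f η) (ha : IsAtomicFor f η) :
    ∀ᵐ x ∂η, f x ≠ 0 → η {x} ≠ 0 := by
  have key : ∀ n, ∀ᵐ x ∂η, x ∈ levelSet f n → η {x} ≠ 0 := by
    intro n
    have hB := measurableSet_levelSet hf n
    have hfin : IsFiniteMeasure (η.restrict (levelSet f n)) :=
      ⟨by rw [Measure.restrict_apply_univ]; exact hη.measure_norm_ge_lt_top (by positivity)⟩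
    have hnull : η (⋃ b ∈ {b ∈ TopologicalSpace.countableBasis E | η (b ∩ levelSet f n) = 0},
        b ∩ levelSet f n) = 0 :=
      (measure_biUnion_null_iff ((TopologicalSpace.countable_countableBasis E).mono
        (Set.sep_subset _ _))).2 fun b hb => hb.2
    refine measure_mono_null (fun x hx => ?_) hnull
    simp only [ne_eq, Set.mem_compl_iff, Set.mem_ofPred_eq, Classical.not_imp, not_not] at hx
    obtain ⟨hxB, hx0⟩ := hx
    have h1 : (η.restrict (levelSet f n)) {x} < 1 :=
      lt_of_le_of_lt (Measure.restrict_apply_le _ _) (by rw [hx0]; exact zero_lt_one)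
    obtain ⟨U, hU, hUo, hU1⟩ := Set.exists_isOpen_lt_of_lt {x} 1 h1
    obtain ⟨b, hb, hxb, hbU⟩ := (TopologicalSpace.isBasis_countableBasis E).exists_subset_of_mem_open
      (hU rfl) hUo
    refine Set.mem_biUnion (x := b) ⟨hb, (ha n b hb).resolve_right (not_le.2 ?_)⟩ ⟨hxb, hxB⟩
    refine lt_of_le_of_lt ?_ hU1
    rw [← Measure.restrict_apply' hB]
    exact measure_mono hbU
  filter_upwards [ae_all_iff.2 key] with x hx h0
  obtain ⟨n, hn⟩ := exists_mem_levelSet h0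
  exact hx n hn

theorem countable_atoms [MeasurableSingletonClass E] {f : E → ℝ}
    {η : Measure E} (hη : Integrable f η) : {x | f x ≠ 0 ∧ η {x} ≠ 0}.Countable := by
  have h : {x | f x ≠ 0 ∧ η {x} ≠ 0} ⊆
      ⋃ n, {x | 0 < (η.restrict (levelSet f n)) {x}} := by
    rintro x ⟨h0, hx⟩
    obtain ⟨n, hn⟩ := exists_mem_levelSet h0
    refine Set.mem_iUnion.2 ⟨n, ?_⟩
    simp only [Set.mem_ofPred_eq]
    rw [Measure.restrict_apply (measurableSet_singleton x),
      Set.inter_eq_left.2 (Set.singleton_subset_iff.2 hn)]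
    exact pos_iff_ne_zero.2 hx
  refine (Set.countable_iUnion fun n => ?_).mono h
  have hfin : IsFiniteMeasure (η.restrict (levelSet f n)) :=
    ⟨by rw [Measure.restrict_apply_univ]; exact hη.measure_norm_ge_lt_top (by positivity)⟩
  exact Measure.countable_meas_pos_of_disjoint_iUnion (fun x => measurableSet_singleton x)
    fun x y hxy => Set.disjoint_singleton.2 hxy

theorem pointProd_exp [TopologicalSpace.PseudoMetrizableSpace E] [BorelSpace E]
    [MeasurableSingletonClass E] {f : E → ℝ} (hf : Measurable f) {η : Measure E}
    (hη : Integrable f η) (ha : IsAtomicFor f η) :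
    pointProd (fun x => Real.exp (f x)) η = Real.exp (∫ x, f x ∂η) := by
  set S := {x | f x ≠ 0 ∧ η {x} ≠ 0} with hS
  have hSc : S.Countable := countable_atoms hη
  have : Countable S := hSc
  have h1 : ∫ x in S, f x ∂η = ∫ x, f x ∂η := by
    refine setIntegral_eq_integral_of_ae_compl_eq_zero ?_
    filter_upwards [ae_singleton_ne_zero hf hη ha] with x hx hxS
    by_contra h0
    exact hxS ⟨h0, hx h0⟩
  have h2 : HasSum (fun x : S => ∫ y in {(x : E)}, f y ∂η)
      (∫ y in ⋃ x : S, {(x : E)}, f y ∂η) :=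
    hasSum_integral_iUnion (fun x => measurableSet_singleton _)
      (fun x y hxy => Set.disjoint_singleton.2 (Subtype.coe_injective.ne hxy)) hη.integrableOn
  rw [Set.iUnion_of_singleton_coe, h1] at h2
  -- Outside `S` either f or the mass of the point vanishes, so the sum extends by zeros to all of
  -- E.
  have h3 : HasSum (fun x : E => f x * η.real {x}) (∫ x, f x ∂η) := by
    refine (hasSum_subtype_iff_of_support_subset (s := S) ?_).1 ?_
    · intro x hx
      rw [Function.mem_support] at hx
      refine ⟨left_ne_zero_of_mul hx, fun h => right_ne_zero_of_mul hx ?_⟩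
      rw [measureReal_def, h, ENNReal.toReal_zero]
    · convert! h2 using 1
      ext x
      rw [integral_singleton, smul_eq_mul, mul_comm]
      rfl
  have h4 := h3.rexp
  rw [pointProd, ← h4.tprod_eq]
  refine tprod_congr fun x => ?_
  rw [← Real.exp_mul]
  rfl

theorem isAtomicFor_cascade [OpensMeasurableSpace E] [AddMonoid E] [MeasurableAdd₂ E] {f : E → ℝ}
    (hf : Measurable f) (ω : Sample E × (ℕ × ℕ → Tree E)) : IsAtomicFor f (cascade ω) := by
  classical
  intro n b hb
  rw [cascade_eq_sum_clusterAt]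
  refine measure_sum_zero_or_one_le (fun i A hA => ?_) _
    ((TopologicalSpace.isOpen_of_mem_countableBasis hb).measurableSet.inter
      (measurableSet_levelSet hf n))
  split_ifs
  · refine measure_sum_zero_or_one_le (fun u A hA => ?_) A hA
    split_ifs
    · rw [Measure.dirac_apply' _ hA]
      by_cases h : (ω.1.point i + (ω.2 i).pos u) ∈ A <;> simp [h]
    · simp
  · simp

end Atomic

/-! ### The exponential formulas for clusters and for the Hawkes process -/

section Functionals

variable {E : Type*} [MeasurableSpace E] [AddMonoid E]

theorem clusterIntegrable_add_iff (γ : Measure E) [SFinite γ] (z x : E) (f : E → ℝ) :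
    ClusterIntegrable γ x (fun y => f (z + y)) ↔ ClusterIntegrable γ (z + x) f := by
  simp only [ClusterIntegrable, add_assoc]

theorem clusterMGFl_add (γ : Measure E) [SFinite γ] (z x : E) (f : E → ℝ) :
    clusterMGFl γ x (fun y => f (z + y)) = clusterMGFl γ (z + x) f := by
  simp only [clusterMGFl, clusterPGFl, add_assoc]

variable [MeasurableAdd₂ E]

theorem clusterMGFl_eq_mul_hawkesMGFl (γ : Measure E) [SFinite γ] (z : E) (f : E → ℝ) :
    clusterMGFl γ z f = Real.exp (f z) * hawkesMGFl γ γ (fun x => f (z + x)) := by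
  rw [clusterMGFl, clusterPGFl, progenyLaw_eq_hawkesLaw]
  rfl

open Classical in
theorem cascade_unbundle (s : Sample (E × Tree E)) :
    cascade (unbundle s) = Measure.sum fun i : ℕ × ℕ =>
      if s.Occurs i then clusterAt (s.point i) else 0 :=
  cascade_eq_sum_clusterAt _

theorem hasSum_eval_cascade {f : E → ℝ} {s : Sample (E × Tree E)}
    (h : Integrable f (cascade (unbundle s))) :
    HasSum (s.eval fun y => ∫ x, f x ∂(clusterAt y)) (∫ x, f x ∂(cascade (unbundle s))) := by
  classical
  rw [cascade_unbundle] at h ⊢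
  convert! hasSum_integral_measure h using 1
  ext i
  unfold Sample.eval
  split_ifs <;> simp

theorem integrable_clusterAt_of_occurs {f : E → ℝ} {s : Sample (E × Tree E)}
    (h : Integrable f (cascade (unbundle s))) (i : ℕ × ℕ) (hi : s.Occurs i) :
    Integrable f (clusterAt (s.point i)) := by
  classical
  rw [cascade_unbundle] at h
  have h1 := h.mono_measure (Measure.le_sum _ i)
  rwa [if_pos hi] at h1

variable [MeasurableSingletonClass E]

theorem integrable_clusterAt_iff {f : E → ℝ} (hf : Measurable f) (z : E) (T : Tree E) :
    Integrable f (clusterAt (z, T)) ↔ Integrable (fun x => f (z + x)) (progeny T) := by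
  have hm : Measurable fun x : E => z + x := measurable_const.add measurable_id
  rw [← dirac_add_map_progeny, integrable_add_measure,
    integrable_map_measure hf.aestronglyMeasurable hm.aemeasurable]
  exact and_iff_right (integrable_dirac (by simp))

theorem integral_clusterAt {f : E → ℝ} (hf : Measurable f) {z : E} {T : Tree E}
    (h : Integrable f (clusterAt (z, T))) :
    ∫ x, f x ∂(clusterAt (z, T)) = f z + ∫ x, f (z + x) ∂(progeny T) := by
  have hm : Measurable fun x : E => z + x := measurable_const.add measurable_id
  rw [← dirac_add_map_progeny] at h ⊢
  rw [integral_add_measure (integrable_add_measure.1 h).1 (integrable_add_measure.1 h).2,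
    integral_dirac, integral_map hm.aemeasurable hf.aestronglyMeasurable]

variable [TopologicalSpace E] [SecondCountableTopology E]
  [TopologicalSpace.PseudoMetrizableSpace E] [BorelSpace E]

theorem ae_hawkesLaw_pointProd_exp (γ ν : Measure E) [SFinite γ] [SFinite ν] {f : E → ℝ}
    (hf : Measurable f) (h : ∀ᵐ η ∂(hawkesLaw γ ν), Integrable f η) :
    ∀ᵐ η ∂(hawkesLaw γ ν), pointProd (fun x => Real.exp (f x)) η = Real.exp (∫ x, f x ∂η) := by
  have ha : ∀ᵐ η ∂(hawkesLaw γ ν), IsAtomicFor f η :=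
    (ae_map_iff measurable_cascade.aemeasurable (measurableSet_isAtomicFor hf)).2
      (ae_of_all _ fun ω => isAtomicFor_cascade hf ω)
  filter_upwards [h, ha] with η h1 h2
  exact pointProd_exp hf h1 h2

theorem hawkesMGFl_eq (γ ν : Measure E) [SFinite γ] [SFinite ν] {f : E → ℝ}
    (hf : Measurable f) (h : ∀ᵐ η ∂(hawkesLaw γ ν), Integrable f η) :
    hawkesMGFl γ ν f = ∫ η, Real.exp (∫ x, f x ∂η) ∂(hawkesLaw γ ν) :=
  integral_congr_ae (ae_hawkesLaw_pointProd_exp γ ν hf h)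

theorem clusterMGFl_eq (γ : Measure E) [SFinite γ] {f : E → ℝ} (hf : Measurable f) (z : E)
    (h : ∀ᵐ η ∂(progenyLaw γ), Integrable (fun x => f (z + x)) η) :
    clusterMGFl γ z f = ∫ η, Real.exp (f z + ∫ x, f (z + x) ∂η) ∂(progenyLaw γ) := by
  rw [clusterMGFl_eq_mul_hawkesMGFl]
  rw [progenyLaw_eq_hawkesLaw] at h ⊢
  rw [hawkesMGFl_eq γ γ (f := fun x => f (z + x))
    (hf.comp (measurable_const.add measurable_id)) h, ← integral_const_mul]
  simp only [Real.exp_add]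

theorem clusterIntegrable_of_clusterAt (γ : Measure E) [SFinite γ] {f : E → ℝ}
    (hf : Measurable f) {z : E} (h1 : ∀ᵐ T ∂(treeLaw γ), Integrable f (clusterAt (z, T)))
    (h2 : Integrable (fun T => Real.exp (∫ x, f x ∂(clusterAt (z, T)))) (treeLaw γ)) :
    ClusterIntegrable γ z f ∧
      clusterMGFl γ z f = ∫ T, Real.exp (∫ x, f x ∂(clusterAt (z, T))) ∂(treeLaw γ) := by
  have hfz : Measurable fun x : E => f (z + x) := hf.comp (measurable_const.add measurable_id)
  have hexp : Measurable fun η : Measure E => Real.exp (f z + ∫ x, f (z + x) ∂η) :=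
    ((measurable_integral_measure hfz).const_add _).exp
  have hae : ∀ᵐ η ∂(progenyLaw γ), Integrable (fun x => f (z + x)) η :=
    (ae_map_iff measurable_progeny.aemeasurable (measurableSet_integrable_measure hfz)).2
      (h1.mono fun T hT => (integrable_clusterAt_iff hf z T).1 hT)
  have hcongr : (fun T => Real.exp (∫ x, f x ∂(clusterAt (z, T)))) =ᵐ[treeLaw γ]
      fun T => Real.exp (f z + ∫ x, f (z + x) ∂(progeny T)) :=
    h1.mono fun T hT => by dsimp only; rw [integral_clusterAt hf hT]
  refine ⟨⟨hae, ?_⟩, ?_⟩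
  · exact (integrable_map_measure hexp.aestronglyMeasurable measurable_progeny.aemeasurable).2
      (h2.congr hcongr)
  · rw [clusterMGFl_eq γ hf z hae, progenyLaw,
      integral_map measurable_progeny.aemeasurable hexp.aestronglyMeasurable]
    exact integral_congr_ae hcongr.symm

theorem hawkes_exp_formula (γ ν : Measure E) [SFinite γ] [SFinite ν] {f : E → ℝ}
    (hf : Measurable f) (h : HawkesIntegrable γ ν f) :
    hawkesMGFl γ ν f = ∫ η, Real.exp (∫ x, f x ∂η) ∂(hawkesLaw γ ν) ∧
      (∀ᵐ z ∂ν, ClusterIntegrable γ z f) ∧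
      Integrable (fun z => clusterMGFl γ z f - 1) ν ∧
      hawkesMGFl γ ν f = Real.exp (∫ z, (clusterMGFl γ z f - 1) ∂ν) := by
  obtain ⟨h1, h2⟩ := h
  have hmgf := hawkesMGFl_eq γ ν hf h1
  have hexp : Measurable fun η : Measure E => Real.exp (∫ x, f x ∂η) :=
    (measurable_integral_measure hf).exp
  have hF : Measurable fun y : E × Tree E => ∫ x, f x ∂(clusterAt y) :=
    (measurable_integral_measure hf).comp measurable_clusterAt
  have hmeas : Measurable fun s : Sample (E × Tree E) => cascade (unbundle s) :=
    measurable_cascade.comp measurable_unbundle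
  set Q := layeredLaw (fun j => (sfiniteSeq ν j Set.univ).toNNReal)
    (fun j => (normalized (sfiniteSeq ν j)).prod (treeLaw γ)) with hQ
  have hlaw : hawkesLaw γ ν = Q.map fun s => cascade (unbundle s) := by
    rw [hawkesLaw, sampleLaw_prod_eq, Measure.map_map measurable_cascade measurable_unbundle]
    rfl
  rw [hlaw] at h1 h2 hmgf ⊢
  rw [integrable_map_measure hexp.aestronglyMeasurable hmeas.aemeasurable] at h2
  rw [integral_map hmeas.aemeasurable hexp.aestronglyMeasurable] at hmgf ⊢
  replace h1 := ae_of_ae_map hmeas.aemeasurable h1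
  have hcongr : (fun s => Real.exp (∫ x, f x ∂(cascade (unbundle s)))) =ᵐ[Q]
      fun s => Real.exp (∑' i, s.eval (fun y => ∫ x, f x ∂(clusterAt y)) i) :=
    h1.mono fun s hs => by dsimp only; rw [(hasSum_eval_cascade hs).tsum_eq]
  obtain ⟨hI, hE⟩ := layeredLaw_exp _ _ hF (h1.mono fun s hs => (hasSum_eval_cascade hs).summable)
    (h2.congr hcongr)
  -- Integrability of f on every cluster that occurs passes to almost every pair (z, T) for the
  -- intensity ν ⊗ `treeLaw γ`.
  have hint := ae_of_forall_occurs _ _ (p := fun y : E × Tree E => Integrable f (clusterAt y))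
    (measurable_clusterAt (measurableSet_integrable_measure hf))
    (h1.mono fun s hs => integrable_clusterAt_of_occurs hs)
  rw [sum_smul_normalized_prod] at hI hE hint
  have hcl : ∀ᵐ z ∂ν, ClusterIntegrable γ z f ∧ clusterMGFl γ z f - 1 =
      ∫ T, (Real.exp (∫ x, f x ∂(clusterAt (z, T))) - 1) ∂(treeLaw γ) := by
    filter_upwards [Measure.ae_ae_of_ae_prod hint, hI.prod_right_ae] with z hz1 hz2
    have hz3 : Integrable (fun T => Real.exp (∫ x, f x ∂(clusterAt (z, T)))) (treeLaw γ) := by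
      simpa only [Pi.add_def, sub_add_cancel] using hz2.add (integrable_const (1 : ℝ))
    obtain ⟨hz4, hz5⟩ := clusterIntegrable_of_clusterAt γ hf hz1 hz3
    refine ⟨hz4, ?_⟩
    rw [hz5, integral_sub hz3 (integrable_const 1)]
    simp
  have hcl2 := hcl.mono fun z hz => hz.2
  refine ⟨hmgf, hcl.mono fun z hz => hz.1,
    hI.integral_prod_left.congr (hcl2.mono fun z hz => hz.symm), ?_⟩
  rw [hmgf, integral_congr_ae hcongr, hE, integral_prod _ hI, integral_congr_ae hcl2]

theorem cluster_exp_formula (γ : Measure E) [SFinite γ] {f : E → ℝ} (hf : Measurable f) (z : E)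
    (h : ClusterIntegrable γ z f) :
    clusterMGFl γ z f = ∫ η, Real.exp (f z + ∫ x, f (z + x) ∂η) ∂(progenyLaw γ) ∧
      (∀ᵐ x ∂γ, ClusterIntegrable γ (z + x) f) ∧
      Integrable (fun x => clusterMGFl γ (z + x) f - 1) γ ∧
      clusterMGFl γ z f = Real.exp (f z + ∫ x, (clusterMGFl γ (z + x) f - 1) ∂γ) := by
  have hfz : Measurable fun x : E => f (z + x) := hf.comp (measurable_const.add measurable_id)
  have hH : HawkesIntegrable γ γ fun x => f (z + x) := by
    rw [HawkesIntegrable, ← progenyLaw_eq_hawkesLaw]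
    refine ⟨h.1, ?_⟩
    -- The ancestor's factor e^{f(z)} is divided out, leaving the progeny alone.
    have h2 := h.2.const_mul (Real.exp (-f z))
    simpa only [← Real.exp_add, neg_add_cancel_left] using h2
  obtain ⟨-, h2, h3, h4⟩ := hawkes_exp_formula γ γ hfz hH
  simp only [clusterIntegrable_add_iff, clusterMGFl_add] at h2 h3 h4
  refine ⟨clusterMGFl_eq γ hf z h.1, h2, h3, ?_⟩
  rw [clusterMGFl_eq_mul_hawkesMGFl, h4, Real.exp_add]

end Functionals

end Hawkes

theorem mainTheorem3 (d : ℕ) (γ ν : Measure (EuclideanSpace ℝ (Fin d))) [SFinite γ] [SFinite ν]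
    (f : EuclideanSpace ℝ (Fin d) → ℝ) (hf : Measurable f) :
    (∀ z : EuclideanSpace ℝ (Fin d), Hawkes.ClusterIntegrable γ z f →
      Hawkes.clusterMGFl γ z f =
          ∫ η, Real.exp (f z + ∫ x, f (z + x) ∂η) ∂(Hawkes.progenyLaw γ) ∧
        (∀ᵐ x ∂γ, Hawkes.ClusterIntegrable γ (z + x) f) ∧
        Integrable (fun x => Hawkes.clusterMGFl γ (z + x) f - 1) γ ∧
        Hawkes.clusterMGFl γ z f =
          Real.exp (f z + ∫ x, (Hawkes.clusterMGFl γ (z + x) f - 1) ∂γ)) ∧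
    (Hawkes.HawkesIntegrable γ ν f →
      Hawkes.hawkesMGFl γ ν f = ∫ η, Real.exp (∫ x, f x ∂η) ∂(Hawkes.hawkesLaw γ ν) ∧
        (∀ᵐ z ∂ν, Hawkes.ClusterIntegrable γ z f) ∧
        Integrable (fun z => Hawkes.clusterMGFl γ z f - 1) ν ∧
        Hawkes.hawkesMGFl γ ν f =
          Real.exp (∫ z, (Hawkes.clusterMGFl γ z f - 1) ∂ν)) := by
  exact ⟨fun z hz => Hawkes.cluster_exp_formula γ hf z hz, Hawkes.hawkes_exp_formula γ ν hf⟩
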